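/- Let $L>0$, let $M\ge 2$, $n\ge 1$, $d\ge 1$ be integers, and let $x\ge 0$ satisfy $\frac{\log M+x}{n}<3$. Let $\mathcal F$ be the class of all probability densities $f$ with respect to Lebesgue measure on $\mathbb R^d$ such that $\|f\|_\infty\le L$. For $f\in\mathcal F$ let $\mathbb P_f$ denote the law of $n$ i.i.d. observations $X_1,\dots,X_n$ with density $f$, and let $\|\cdot\|$ be the norm of $L^2(\mathbb R^d)$. Given a dictionary $f_1,\dots,f_M$, a selector is an estimator of the form $\hat S_n=f_{\hat J}$, where $\hat J$ is a measurable function of $X_1,\dots,X_n$ with values in $\{1,\dots,M\}$. Then there exist (real-valued) functions $f_1,\dots,f_M\in L^2(\mathbb R^d)$ with $\|f_j\|_\infty\le L$ for every $j$ such that for every selector $\hat S_n$ there is a density $f\in\mathcal F$ with $$\mathbb P_f\left(\|\hat S_n-f\|^2-\inf_{j=1,\dots,M}\|f_j-f\|^2\ \ge\ \frac{L}{\sqrt3}\sqrt{\frac{x+\log M}{n}}\right)\ \ge\ \frac1{24}\,e^{-x}.$$ In particular, the infimum over all selectors $\hat S_n$ of the supremum over $f\in\mathcal F$ of the probability on the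 left is at least $\frac1{24}e^{-x}$. -/

import Mathlib

open MeasureTheory

noncomputable section

namespace DensitySelectors

/-- A probability density with respect to Lebesgue measure on `ℝ^d`. -/
structure IsDensity {d : ℕ} (f : (Fin d → ℝ) → ℝ) : Prop where
  measurable : Measurable f
  nonneg : ∀ u, 0 ≤ f u
  lintegral_eq_one : ∫⁻ u, ENNReal.ofReal (f u) = 1

/-- The class of densities `f` on `ℝ^d` whose essential supremum norm is at most `L`. -/
def boundedDensities (d : ℕ) (L : ℝ) : Set ((Fin d → ℝ) → ℝ) :=
  {f | IsDensity f ∧ eLpNorm f ⊤ volume ≤ ENNReal.ofReal L}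

/-- The law of `n` i.i.d. observations with density `f`. -/
def sampleLaw {d : ℕ} (n : ℕ) (f : (Fin d → ℝ) → ℝ) : Measure (Fin n → (Fin d → ℝ)) :=
  Measure.pi fun _ => volume.withDensity fun u => ENNReal.ofReal (f u)

/-- The squared `L²` distance `‖g - f‖²` (used only for `f` and `g` in `L²`). -/
def sqDist {d : ℕ} (g f : (Fin d → ℝ) → ℝ) : ℝ :=
  ∫ u, (g u - f u) ^ 2

/-- The excess risk `‖g - f‖² - inf_j ‖f_j - f‖²` of `g` over the dictionary `dict`. -/
def excessRisk {d M : ℕ} (dict : Fin M → (Fin d → ℝ) → ℝ) (f g : (Fin d → ℝ) → ℝ) : ℝ :=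
  sqDist g f - ⨅ j, sqDist (dict j) f

/-- A selector is an estimator of the form `dict Ĵ`, where the index `Ĵ` is a measurable
function of the `n` observations. -/
def IsSelector {d M n : ℕ} (dict : Fin M → (Fin d → ℝ) → ℝ)
    (S : (Fin n → (Fin d → ℝ)) → (Fin d → ℝ) → ℝ) : Prop :=
  ∃ J : (Fin n → (Fin d → ℝ)) → Fin M, Measurable J ∧ ∀ X, S X = dict (J X)

end DensitySelectors

end

namespace DensitySelectors

open scoped ENNReal

/-! Split a box of volume `2 / L` into `2 ^ M` equal cells labelled by sign vectors `w`. The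
dictionary is `L * w j`, the null density is `L / 2`, and the alternatives are `L / 2 * (1 + γ * w
k)`. Distinct signs are orthogonal, so under alternative `k` every `j ≠ k` has excess risk at least
`2 * L * γ`, which is the target rate for `γ ^ 2 = (x + log M) / (12 * n)`. It remains to bound
below the probability of selecting wrongly.

Some `k` is selected with probability at most `1 / M` under the null. Second moments of the density
ratio transfer this to alternative `k` (`sampleLaw_real_le_of_secondMoment`). In
`wrong_selection_lower_bound`, for `x ≤ log M` the event of selecting `k` stays far from certain;
for `x ≥ log M` the reverse ratio shows that its complement keeps mass of order `exp (-x)`. -/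

/-! ### Product laws and change of measure. -/

theorem lintegral_fin_prod_eq_prod {n : ℕ} {E : Type*} [MeasurableSpace E]
    (μ : Measure E) [SigmaFinite μ] (f : Fin n → E → ℝ≥0∞) (hf : ∀ i, Measurable (f i)) :
    ∫⁻ X : Fin n → E, ∏ i, f i (X i) ∂(Measure.pi fun _ => μ) = ∏ i, ∫⁻ u, f i u ∂μ := by
  induction n with
  | zero => simp
  | succ n ih =>
    have hm := (measurePreserving_piFinSuccAbove (fun _ : Fin (n + 1) => μ) 0).symm
    rw [← hm.map_eq, lintegral_map (by fun_prop) hm.measurable]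
    simp_rw [MeasurableEquiv.piFinSuccAbove_symm_apply, Fin.insertNthEquiv,
      Fin.prod_univ_succ, Fin.insertNth_zero, Equiv.coe_fn_mk, Fin.cons_succ, Fin.cons_zero]
    rw [← ih (fun i => f i.succ) fun i => hf _]
    exact lintegral_prod_mul (μ := μ) (ν := Measure.pi fun _ => μ) (hf 0).aemeasurable
      (g := fun X : Fin n → E => ∏ i, f i.succ (X i))
      (Finset.measurable_prod _ fun i _ => (hf i.succ).comp (measurable_pi_apply i)).aemeasurable

/-- Rectangles determine the product measure, and on them indicator times density factorizes over
coordinates. -/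
theorem pi_withDensity {n : ℕ} {E : Type*} [MeasurableSpace E] (μ : Measure E) [SigmaFinite μ]
    (r : E → ℝ≥0∞) (hr : Measurable r) [SigmaFinite (μ.withDensity r)] :
    (Measure.pi fun _ : Fin n => μ.withDensity r) =
      (Measure.pi fun _ : Fin n => μ).withDensity fun X => ∏ i, r (X i) := by
  refine Measure.pi_eq fun s hs => ?_
  rw [withDensity_apply _ (MeasurableSet.univ_pi hs),
    ← lintegral_indicator (MeasurableSet.univ_pi hs)]
  have : ∀ X : Fin n → E, (Set.univ.pi s).indicator (fun X => ∏ i, r (X i)) X =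
      ∏ i, (s i).indicator r (X i) := by
    intro X
    by_cases hX : X ∈ Set.univ.pi s
    · rw [Set.indicator_of_mem hX]
      exact Finset.prod_congr rfl fun i _ => (Set.indicator_of_mem (hX i trivial) _).symm
    · rw [Set.indicator_of_notMem hX]
      simp only [Set.mem_pi, Set.mem_univ, true_implies, not_forall] at hX
      obtain ⟨i, hi⟩ := hX
      exact (Finset.prod_eq_zero (Finset.mem_univ i) (Set.indicator_of_notMem hi _)).symm
  simp_rw [this]
  rw [lintegral_fin_prod_eq_prod μ _ fun i => hr.indicator (hs i)]
  exact Finset.prod_congr rfl fun i _ => by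
    rw [lintegral_indicator (hs i), withDensity_apply _ (hs i)]

theorem IsDensity.isProbabilityMeasure {d : ℕ} {f : (Fin d → ℝ) → ℝ} (hf : IsDensity f) :
    IsProbabilityMeasure (volume.withDensity fun u => ENNReal.ofReal (f u)) :=
  ⟨by rw [withDensity_apply _ MeasurableSet.univ, setLIntegral_univ, hf.lintegral_eq_one]⟩

theorem IsDensity.isProbabilityMeasure_sampleLaw {d : ℕ} (n : ℕ) {f : (Fin d → ℝ) → ℝ}
    (hf : IsDensity f) : IsProbabilityMeasure (sampleLaw n f) := by
  have := hf.isProbabilityMeasure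
  unfold sampleLaw
  infer_instance

/-- Change of law from `g` to `f = g * r`, controlled by the second moment of the density ratio. -/
theorem sampleLaw_real_le_of_secondMoment {d n : ℕ} {f g r : (Fin d → ℝ) → ℝ} (hf : IsDensity f)
    (hg : IsDensity g) (hr : Measurable r) (hr0 : ∀ u, 0 ≤ r u) (hfg : ∀ u, f u = g u * r u)
    {c : ℝ} (hc : 0 ≤ c) (hcr : ∫⁻ u, ENNReal.ofReal (g u * r u ^ 2) = ENNReal.ofReal c)
    {a : ℝ} (ha : 0 < a) {B : Set (Fin n → Fin d → ℝ)} (hB : MeasurableSet B) :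
    (sampleLaw n f).real B ≤ a / 2 * (sampleLaw n g).real B + c ^ n / (2 * a) := by
  have := hf.isProbabilityMeasure
  have := hg.isProbabilityMeasure
  have := hf.isProbabilityMeasure_sampleLaw n
  have := hg.isProbabilityMeasure_sampleLaw n
  have hgm := hg.measurable
  set ν := volume.withDensity fun u => ENNReal.ofReal (g u) with hν
  have hfν : (volume.withDensity fun u => ENNReal.ofReal (f u)) =
      ν.withDensity fun u => ENNReal.ofReal (r u) := by
    rw [hν, ← withDensity_mul _ (by fun_prop) (by fun_prop)]
    congr 1
    ext u
    simp [hfg, ENNReal.ofReal_mul (hg.nonneg u)]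
  have hlaw : sampleLaw n f =
      (sampleLaw n g).withDensity fun X => ∏ i, ENNReal.ofReal (r (X i)) := by
    have : IsProbabilityMeasure (ν.withDensity fun u => ENNReal.ofReal (r u)) := hfν ▸ ‹_›
    unfold sampleLaw
    rw [hfν, pi_withDensity ν _ (by fun_prop)]
  have hmom : ∫⁻ X, ∏ i, ENNReal.ofReal (r (X i) ^ 2) ∂(sampleLaw n g) =
      ENNReal.ofReal (c ^ n) := by
    unfold sampleLaw
    rw [lintegral_fin_prod_eq_prod ν (fun _ u => ENNReal.ofReal (r u ^ 2)) (by fun_prop),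
      Finset.prod_const, Finset.card_univ, Fintype.card_fin, ENNReal.ofReal_pow hc, hν,
      lintegral_withDensity_eq_lintegral_mul _ (by fun_prop) (by fun_prop), ← hcr]
    congr 2
    ext u
    simp [ENNReal.ofReal_mul (hg.nonneg u)]
  have hle : sampleLaw n f B ≤
      ENNReal.ofReal (a / 2 * (sampleLaw n g).real B + c ^ n / (2 * a)) := by
    calc sampleLaw n f B
        = ∫⁻ X in B, ∏ i, ENNReal.ofReal (r (X i)) ∂(sampleLaw n g) := by
          rw [hlaw, withDensity_apply _ hB]
      _ ≤ ∫⁻ X in B, (ENNReal.ofReal (a / 2) +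
            ENNReal.ofReal (1 / (2 * a)) * ∏ i, ENNReal.ofReal (r (X i) ^ 2))
            ∂(sampleLaw n g) := by
          refine lintegral_mono fun X => ?_
          rw [← ENNReal.ofReal_prod_of_nonneg fun i _ => hr0 _,
            ← ENNReal.ofReal_prod_of_nonneg fun i _ => sq_nonneg _,
            ← ENNReal.ofReal_mul (by positivity),
            ← ENNReal.ofReal_add (by positivity)
              (mul_nonneg (by positivity) (Finset.prod_nonneg fun i _ => sq_nonneg _)),
            Finset.prod_pow]
          refine ENNReal.ofReal_le_ofReal ?_
          -- AM-GM in the form `y ≤ a / 2 + y ^ 2 / (2 * a)`.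
          generalize ∏ i, r (X i) = y
          have : a / 2 + 1 / (2 * a) * y ^ 2 - y = (y - a) ^ 2 / (2 * a) := by
            field_simp; ring
          have : 0 ≤ (y - a) ^ 2 / (2 * a) := by positivity
          linarith
      _ ≤ ENNReal.ofReal (a / 2) * sampleLaw n g B + ENNReal.ofReal (1 / (2 * a)) *
            ∫⁻ X, ∏ i, ENNReal.ofReal (r (X i) ^ 2) ∂(sampleLaw n g) := by
          rw [lintegral_add_left measurable_const, setLIntegral_const,
            lintegral_const_mul _ (by fun_prop)]
          gcongr
          exact Measure.restrict_le_self
      _ = _ := by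
          rw [hmom, ← ENNReal.ofReal_mul (by positivity), ← ofReal_measureReal,
            ← ENNReal.ofReal_mul (by positivity), ← ENNReal.ofReal_add (by positivity)
              (by positivity)]
          congr 1
          ring
  exact ENNReal.toReal_le_of_le_ofReal (by positivity) hle

/-! ### Functions constant on labelled cells. -/

/-- A cell partition of a box: measurable labels `T` on `Q` such that every label has a cell
of volume `δ`. -/
theorem exists_labelled_box {d : ℕ} (hd : 1 ≤ d) (ι : Type*) [Fintype ι] [Nonempty ι]
    [MeasurableSpace ι] {δ : ℝ} (hδ : 0 < δ) :
    ∃ (Q : Set (Fin d → ℝ)) (T : (Fin d → ℝ) → ι), MeasurableSet Q ∧ Measurable T ∧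
      ∀ w, volume (Q ∩ T ⁻¹' {w}) = ENNReal.ofReal δ := by
  classical
  let e := Fintype.equivFin ι
  let z : Fin d := ⟨0, hd⟩
  -- Cells are slabs of width `δ` along coordinate `z`; the default label occurs only outside the
  -- box.
  let lab : ℕ → ι := fun m => if h : m < Fintype.card ι then e.symm ⟨m, h⟩ else Classical.arbitrary ι
  refine ⟨Set.univ.pi fun i => if i = z then Set.Ico 0 (Fintype.card ι * δ) else Set.Ico 0 1,
    fun u => lab ⌊u z / δ⌋₊, MeasurableSet.univ_pi fun i => by split_ifs <;> exact measurableSet_Ico,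
    (measurable_from_top (f := lab)).comp (Nat.measurable_floor.comp (by fun_prop)), fun w => ?_⟩
  have hset : ((Set.univ.pi fun i => if i = z then Set.Ico 0 (Fintype.card ι * δ) else Set.Ico 0 1) ∩
      (fun u : Fin d → ℝ => lab ⌊u z / δ⌋₊) ⁻¹' {w}) =
      Set.univ.pi fun i => Set.Ico (if i = z then ((e w : ℕ) : ℝ) * δ else 0)
        (if i = z then ((e w : ℕ) + 1 : ℝ) * δ else 1) := by
    ext u
    have key : (0 ≤ u z ∧ u z < Fintype.card ι * δ) ∧ lab ⌊u z / δ⌋₊ = w ↔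
        (e w : ℕ) * δ ≤ u z ∧ u z < ((e w : ℕ) + 1 : ℝ) * δ := by
      constructor
      · rintro ⟨⟨h0, h1⟩, h2⟩
        have hlt : ⌊u z / δ⌋₊ < Fintype.card ι := by
          rw [Nat.floor_lt (by positivity), div_lt_iff₀ hδ]; exact h1
        simp only [lab, hlt, dite_true] at h2
        have h3 : ((e w : Fin _) : ℕ) = ⌊u z / δ⌋₊ := by rw [← h2]; simp
        have := (Nat.floor_eq_iff (by positivity : 0 ≤ u z / δ)).1 h3.symm
        rwa [le_div_iff₀ hδ, div_lt_iff₀ hδ] at this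
      · rintro ⟨h0, h1⟩
        have hu : 0 ≤ u z := le_trans (by positivity) h0
        have h3 : ⌊u z / δ⌋₊ = e w := by
          rw [Nat.floor_eq_iff (by positivity), le_div_iff₀ hδ, div_lt_iff₀ hδ]
          exact ⟨h0, h1⟩
        refine ⟨⟨hu, h1.trans_le ?_⟩, ?_⟩
        · gcongr
          exact_mod_cast (e w).2
        · simp [lab, h3]
    constructor
    · rintro ⟨hu, hw⟩ i -
      have hz := key.1 ⟨by simpa using hu z trivial, hw⟩
      by_cases hi : i = z
      · subst hi; simpa using hz
      · simpa [hi] using hu i trivial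
    · intro hu
      have hz := key.2 (by simpa using hu z trivial)
      refine ⟨fun i _ => ?_, hz.2⟩
      by_cases hi : i = z
      · subst hi; simpa using hz.1
      · simpa [hi] using hu i trivial
  rw [hset, Real.volume_pi_Ico, Finset.prod_eq_single z]
  · simp; ring_nf
  · intro i _ hi; simp [hi]
  · simp

/-- The function equal to `G (T u)` on `Q` and to zero elsewhere. -/
noncomputable def cellFun {d : ℕ} {ι : Type*} (Q : Set (Fin d → ℝ)) (T : (Fin d → ℝ) → ι)
    (G : ι → ℝ) : (Fin d → ℝ) → ℝ :=
  Q.indicator fun u => G (T u)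

theorem cellFun_nonneg {d : ℕ} {ι : Type*} {Q : Set (Fin d → ℝ)} {T : (Fin d → ℝ) → ι}
    {G : ι → ℝ} (hG : ∀ w, 0 ≤ G w) (u : Fin d → ℝ) : 0 ≤ cellFun Q T G u :=
  Set.indicator_nonneg (fun _ _ => hG _) u

theorem eLpNorm_top_cellFun_le {d : ℕ} {ι : Type*} {Q : Set (Fin d → ℝ)} {T : (Fin d → ℝ) → ι}
    {G : ι → ℝ} {C : ℝ} (hC : 0 ≤ C)
    (hG : ∀ w, |G w| ≤ C) :
    eLpNorm (cellFun Q T G) ⊤ volume ≤ ENNReal.ofReal C := by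
  rw [eLpNorm_exponent_top]
  refine eLpNormEssSup_le_of_ae_bound (ae_of_all _ fun u => ?_)
  by_cases hu : u ∈ Q
  · simpa [cellFun, hu] using hG _
  · simpa [cellFun, hu] using hC

section cellFun

variable {d : ℕ} {ι : Type*} [Fintype ι] [MeasurableSpace ι] [MeasurableSingletonClass ι]
  {Q : Set (Fin d → ℝ)} {T : (Fin d → ℝ) → ι} {δ : ℝ}

theorem lintegral_comp_labels (hT : Measurable T)
    (hv : ∀ w, volume (Q ∩ T ⁻¹' {w}) = ENNReal.ofReal δ) (G : ι → ℝ≥0∞) :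
    ∫⁻ u in Q, G (T u) = (∑ w, G w) * ENNReal.ofReal δ := by
  have hG : Measurable G := measurable_of_finite G
  rw [← lintegral_map hG hT, lintegral_fintype, Finset.sum_mul]
  refine Finset.sum_congr rfl fun w _ => ?_
  rw [Measure.map_apply hT (measurableSet_singleton w),
    Measure.restrict_apply (hT (measurableSet_singleton w)), Set.inter_comm, hv]

theorem measurable_cellFun (hQ : MeasurableSet Q) (hT : Measurable T) (G : ι → ℝ) :
    Measurable (cellFun Q T G) :=
  ((measurable_of_finite G).comp hT).indicator hQ

theorem lintegral_cellFun (hQ : MeasurableSet Q) (hT : Measurable T)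
    (hv : ∀ w, volume (Q ∩ T ⁻¹' {w}) = ENNReal.ofReal δ) {G : ι → ℝ} (hG : ∀ w, 0 ≤ G w) :
    ∫⁻ u, ENNReal.ofReal (cellFun Q T G u) = ENNReal.ofReal ((∑ w, G w) * δ) := by
  have : ∀ u, ENNReal.ofReal (cellFun Q T G u) =
      Q.indicator (fun u => ENNReal.ofReal (G (T u))) u := by
    intro u
    by_cases hu : u ∈ Q <;> simp [cellFun, hu]
  simp_rw [this]
  rw [lintegral_indicator hQ, lintegral_comp_labels hT hv fun w => ENNReal.ofReal (G w),
    ENNReal.ofReal_mul (Finset.sum_nonneg fun w _ => hG w),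
    ENNReal.ofReal_sum_of_nonneg fun w _ => hG w]

theorem volume_ne_top_of_cells (hT : Measurable T)
    (hv : ∀ w, volume (Q ∩ T ⁻¹' {w}) = ENNReal.ofReal δ) : volume Q ≠ ⊤ := by
  have := lintegral_comp_labels hT hv fun _ => 1
  rw [setLIntegral_one] at this
  rw [this]
  exact ENNReal.mul_ne_top (by simp) ENNReal.ofReal_ne_top

theorem memLp_cellFun (hQ : MeasurableSet Q) (hT : Measurable T)
    (hv : ∀ w, volume (Q ∩ T ⁻¹' {w}) = ENNReal.ofReal δ) (G : ι → ℝ) :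
    MemLp (cellFun Q T G) 2 volume := by
  have : IsFiniteMeasure (volume.restrict Q) :=
    ⟨by simpa using (volume_ne_top_of_cells hT hv).lt_top⟩
  refine (memLp_indicator_iff_restrict hQ).2 (MemLp.of_bound
    ((measurable_of_finite G).comp hT).aestronglyMeasurable (∑ w, |G w|) (ae_of_all _ fun u => ?_))
  exact Finset.single_le_sum (f := fun w => |G w|) (fun w _ => abs_nonneg _) (Finset.mem_univ (T u))

theorem isDensity_cellFun (hQ : MeasurableSet Q) (hT : Measurable T)
    (hv : ∀ w, volume (Q ∩ T ⁻¹' {w}) = ENNReal.ofReal δ) {G : ι → ℝ} (hG : ∀ w, 0 ≤ G w)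
    (h1 : (∑ w, G w) * δ = 1) : IsDensity (cellFun Q T G) where
  measurable := measurable_cellFun hQ hT G
  nonneg := cellFun_nonneg hG
  lintegral_eq_one := by rw [lintegral_cellFun hQ hT hv hG, h1, ENNReal.ofReal_one]

theorem sqDist_cellFun (hQ : MeasurableSet Q) (hT : Measurable T) (hδ : 0 < δ)
    (hv : ∀ w, volume (Q ∩ T ⁻¹' {w}) = ENNReal.ofReal δ) (G H : ι → ℝ) :
    sqDist (cellFun Q T G) (cellFun Q T H) = (∑ w, (G w - H w) ^ 2) * δ := by
  have : ∀ u, (cellFun Q T G u - cellFun Q T H u) ^ 2 =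
      cellFun Q T (fun w => (G w - H w) ^ 2) u := by
    intro u
    by_cases hu : u ∈ Q <;> simp [cellFun, hu]
  unfold sqDist
  simp_rw [this]
  rw [integral_eq_lintegral_of_nonneg_ae
      (ae_of_all _ (cellFun_nonneg fun _ => sq_nonneg _))
      (measurable_cellFun hQ hT _).aestronglyMeasurable,
    lintegral_cellFun hQ hT hv fun w => sq_nonneg _, ENNReal.toReal_ofReal]
  exact mul_nonneg (Finset.sum_nonneg fun w _ => sq_nonneg _) hδ.le

end cellFun

/-! ### Orthogonality of signs. -/

/-- The sign `±1` of a Boolean. -/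
def boolSign (b : Bool) : ℝ := if b then 1 else -1

theorem boolSign_sq (b : Bool) : boolSign b ^ 2 = 1 := by cases b <;> simp [boolSign]

theorem boolSign_not (b : Bool) : boolSign (!b) = -boolSign b := by cases b <;> simp [boolSign]

theorem abs_boolSign (b : Bool) : |boolSign b| = 1 := by cases b <;> simp [boolSign]

theorem boolSign_eq_or (b : Bool) : boolSign b = 1 ∨ boolSign b = -1 := by
  cases b <;> simp [boolSign]

/-- Flipping bit `k` permutes the sign vectors, so the sum equals its own negative. -/
theorem sum_eq_zero_of_flip {M : ℕ} (k : Fin M) (g : (Fin M → Bool) → ℝ)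
    (hg : ∀ w, g (Function.update w k (!w k)) = -g w) : ∑ w, g w = 0 := by
  have hinv : Function.Involutive fun w : Fin M → Bool => Function.update w k (!w k) := by
    intro w; simp
  have := Equiv.sum_comp hinv.toPerm g
  simp only [Function.Involutive.coe_toPerm, hg, Finset.sum_neg_distrib] at this
  linarith

theorem sum_boolSign {M : ℕ} (k : Fin M) : ∑ w : Fin M → Bool, boolSign (w k) = 0 :=
  sum_eq_zero_of_flip k _ fun w => by simp [boolSign_not]

theorem sum_boolSign_mul {M : ℕ} {j k : Fin M} (h : j ≠ k) :
    ∑ w : Fin M → Bool, boolSign (w j) * boolSign (w k) = 0 :=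
  sum_eq_zero_of_flip k _ fun w => by simp [boolSign_not, h]

theorem sum_one_boolVec (M : ℕ) : ∑ _w : Fin M → Bool, (1 : ℝ) = 2 ^ M := by simp

theorem sum_sq_dict_sub {M : ℕ} (L γ : ℝ) (j k : Fin M) :
    ∑ w : Fin M → Bool, (L * boolSign (w j) - L / 2 * (1 + γ * boolSign (w k))) ^ 2 =
      L ^ 2 * (1 + (1 + γ ^ 2) / 4) * 2 ^ M -
        L ^ 2 * γ * ∑ w : Fin M → Bool, boolSign (w j) * boolSign (w k) := by
  have : ∀ w : Fin M → Bool, (L * boolSign (w j) - L / 2 * (1 + γ * boolSign (w k))) ^ 2 =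
      L ^ 2 * (1 + (1 + γ ^ 2) / 4) * 1 - L ^ 2 * γ * (boolSign (w j) * boolSign (w k)) +
        (L ^ 2 * γ / 2) * boolSign (w k) - L ^ 2 * boolSign (w j) := by
    intro w
    linear_combination L ^ 2 * boolSign_sq (w j) + L ^ 2 * γ ^ 2 / 4 * boolSign_sq (w k)
  simp_rw [this, Finset.sum_sub_distrib, Finset.sum_add_distrib, Finset.sum_sub_distrib,
    ← Finset.mul_sum, sum_boolSign, sum_one_boolVec]
  ring

/-! ### Numerical and testing bounds. -/

theorem div_sqrt_three_mul_sqrt (L : ℝ) {t : ℝ} (ht : 0 ≤ t) :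
    L / Real.sqrt 3 * Real.sqrt t = 2 * L * Real.sqrt (t / 12) := by
  have h : t / 12 = t / 3 / 2 ^ 2 := by ring
  rw [h, Real.sqrt_div (by positivity) (2 ^ 2), Real.sqrt_sq (by norm_num), Real.sqrt_div ht]
  field_simp

theorem exists_measureReal_preimage_le {Ω : Type*} [MeasurableSpace Ω] (P : Measure Ω)
    [IsProbabilityMeasure P] {M : ℕ} (hM : 2 ≤ M) {J : Ω → Fin M} (hJ : Measurable J) :
    ∃ k, P.real (J ⁻¹' {k}) ≤ 1 / M := by
  by_contra! h
  have hsum : ∑ k, P.real (J ⁻¹' {k}) = 1 := by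
    have := sum_measureReal_preimage_singleton (μ := P) (f := J) Finset.univ
      fun y _ => hJ (measurableSet_singleton y)
    simpa using this
  have hlt : ∑ _k : Fin M, (1 / M : ℝ) < ∑ k, P.real (J ⁻¹' {k}) :=
    Finset.sum_lt_sum_of_nonempty ⟨⟨0, by omega⟩, Finset.mem_univ _⟩ fun k _ => h k
  rw [hsum, Finset.sum_const, Finset.card_univ, Fintype.card_fin, nsmul_eq_mul,
    mul_one_div_cancel (by positivity)] at hlt
  exact lt_irrefl _ hlt

/-- If `q` is the probability of a wrong selection under an alternative, and `p` its probability
under the null, then the two change-of-law inequalities bound `q` from below. -/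
theorem wrong_selection_lower_bound {M n : ℕ} (hM : 2 ≤ M) {x g p q : ℝ} (hx : 0 ≤ x)
    (hg0 : 0 ≤ g) (hg : g < 1 / 4) (hng : n * g = (x + Real.log M) / 12) (hp : 1 - p ≤ 1 / M)
    (hto : ∀ a : ℝ, 0 < a → 1 - q ≤ a / 2 * (1 - p) + (1 + g) ^ n / (2 * a))
    (hfrom : ∀ a : ℝ, 0 < a → p ≤ a / 2 * q + (1 / (1 - g)) ^ n / (2 * a)) :
    1 / 24 * Real.exp (-x) ≤ q := by
  have hM2 : (2 : ℝ) ≤ M := by exact_mod_cast hM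
  have hlog : 0 ≤ Real.log M := Real.log_nonneg (by linarith)
  rcases le_total x (Real.log M) with hc | hc
  · have hpow : (1 + g) ^ n ≤ Real.exp (Real.log M / 6) := by
      calc (1 + g) ^ n ≤ Real.exp g ^ n := by
            gcongr
            linarith [Real.add_one_le_exp g]
        _ = Real.exp (n * g) := (Real.exp_nat_mul g n).symm
        _ ≤ _ := Real.exp_le_exp.2 (by rw [hng]; linarith)
    have hs6 : Real.exp (Real.log M / 6) ^ 6 = M := by
      rw [← Real.exp_nat_mul, ← Real.exp_log (by linarith : (0 : ℝ) < M), Real.log_exp]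
      congr 1; push_cast; ring
    set s := Real.exp (Real.log M / 6) with hs
    have hs0 : 0 < s := Real.exp_pos _
    -- Here `s = M ^ (1/6)`, and `1.1 ^ 6 < 2 ≤ M`.
    have h11 : (11 / 10 : ℝ) ≤ s := by
      by_contra! h
      have : s ^ 6 < (11 / 10) ^ 6 := by gcongr
      norm_num at this
      linarith
    -- Taking `a = √M` makes both error terms small; they sum to less than `23 / 24`.
    have h1 := hto (s ^ 3) (by positivity)
    have h2 : s ^ 3 / 2 * (1 - p) ≤ 1 / (2 * s ^ 3) := by
      calc s ^ 3 / 2 * (1 - p) ≤ s ^ 3 / 2 * (1 / M) := by gcongr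
        _ = 1 / (2 * s ^ 3) := by rw [← hs6]; field_simp
    have h3 : (1 + g) ^ n / (2 * s ^ 3) ≤ 1 / (2 * s ^ 2) := by
      calc (1 + g) ^ n / (2 * s ^ 3) ≤ s / (2 * s ^ 3) := by gcongr
        _ = 1 / (2 * s ^ 2) := by field_simp
    have h4 : 1 / (2 * s ^ 3) ≤ 500 / 1331 :=
      (by gcongr : _ ≤ 1 / (2 * (11 / 10 : ℝ) ^ 3)).trans_eq (by norm_num)
    have h5 : 1 / (2 * s ^ 2) ≤ 50 / 121 :=
      (by gcongr : _ ≤ 1 / (2 * (11 / 10 : ℝ) ^ 2)).trans_eq (by norm_num)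
    have h6 : Real.exp (-x) ≤ 1 := Real.exp_le_one_iff.2 (by linarith)
    linarith
  · have hg1 : 0 < 1 - g := by linarith
    have hle : 1 / (1 - g) ≤ Real.exp (2 * g) := by
      calc 1 / (1 - g) ≤ 2 * g + 1 := by
            rw [div_le_iff₀ hg1]; nlinarith
        _ ≤ _ := Real.add_one_le_exp _
    have hpow : (1 / (1 - g)) ^ n ≤ Real.exp x := by
      calc (1 / (1 - g)) ^ n ≤ Real.exp (2 * g) ^ n := by gcongr
        _ = Real.exp (n * (2 * g)) := (Real.exp_nat_mul _ n).symm
        _ ≤ _ := Real.exp_le_exp.2 (by linarith)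
    have hc0 : 0 < (1 / (1 - g)) ^ n := by positivity
    -- This `a` makes the second term `1 / 4`, half of the lower bound `1 / 2` on `p`.
    have h1 := hfrom (2 * (1 / (1 - g)) ^ n) (by positivity)
    set c := (1 / (1 - g)) ^ n
    have h2 : c / (2 * (2 * c)) = 1 / 4 := by field_simp; norm_num
    have h3 : (1 : ℝ) / M ≤ 1 / 2 := by gcongr
    have h4 : 1 / 4 ≤ c * q := by rw [h2] at h1; linarith
    have hq : 0 < q := by
      by_contra! h
      nlinarith
    have h5 : 1 / 4 ≤ Real.exp x * q := h4.trans (by gcongr)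
    have h6 : Real.exp (-x) * Real.exp x = 1 := by rw [← Real.exp_add]; simp
    have h7 : Real.exp (-x) * (1 / 4) ≤ Real.exp (-x) * (Real.exp x * q) := by gcongr
    rw [← mul_assoc, h6, one_mul] at h7
    linarith [Real.exp_pos (-x)]

end DensitySelectors

/-! ### The construction and the conclusion. -/

theorem mainTheorem5 (L : ℝ) (hL : 0 < L) (M n d : ℕ) (hM : 2 ≤ M) (hn : 1 ≤ n) (hd : 1 ≤ d)
    (x : ℝ) (hx : 0 ≤ x) (hxn : (Real.log M + x) / n < 3) :
    ∃ dict : Fin M → (Fin d → ℝ) → ℝ,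
      (∀ j, MemLp (dict j) 2 volume ∧ eLpNorm (dict j) ⊤ volume ≤ ENNReal.ofReal L) ∧
      ∀ S : (Fin n → (Fin d → ℝ)) → (Fin d → ℝ) → ℝ, DensitySelectors.IsSelector dict S →
        ∃ f ∈ DensitySelectors.boundedDensities d L,
          ENNReal.ofReal (1 / 24 * Real.exp (-x)) ≤
            DensitySelectors.sampleLaw n f
              {X | L / Real.sqrt 3 * Real.sqrt ((x + Real.log M) / n) ≤
                DensitySelectors.excessRisk dict f (S X)} := by
  open DensitySelectors in
  have hlog : 0 ≤ Real.log M := Real.log_nonneg (by exact_mod_cast (by omega : 1 ≤ M))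
  have hn0 : (0 : ℝ) < n := by exact_mod_cast hn
  set t : ℝ := (x + Real.log M) / n with ht
  have ht0 : 0 ≤ t := by positivity
  have ht3 : t < 3 := by rwa [ht, add_comm]
  set γ : ℝ := Real.sqrt (t / 12) with hγ
  have hγ2 : γ ^ 2 = t / 12 := Real.sq_sqrt (by positivity)
  have hγ0 : 0 ≤ γ := Real.sqrt_nonneg _
  have hγ1 : γ < 1 / 2 := by nlinarith
  set δ : ℝ := 2 / (L * 2 ^ M) with hδdef
  have hδ : 0 < δ := by positivity
  have hδL : δ * L * 2 ^ M = 2 := by rw [hδdef]; field_simp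
  obtain ⟨Q, T, hQ, hT, hv⟩ := exists_labelled_box hd (Fin M → Bool) hδ
  have hpos : ∀ b, 0 < 1 + γ * boolSign b := fun b => by
    rcases boolSign_eq_or b with h | h <;> rw [h] <;> linarith
  let null : (Fin d → ℝ) → ℝ := cellFun Q T fun _ => L / 2
  let alt : Fin M → (Fin d → ℝ) → ℝ := fun k =>
    cellFun Q T fun w => L / 2 * (1 + γ * boolSign (w k))
  let dict : Fin M → (Fin d → ℝ) → ℝ := fun j => cellFun Q T fun w => L * boolSign (w j)
  have hnull : IsDensity null := isDensity_cellFun hQ hT hv (fun _ => by positivity) (by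
    simp only [Finset.sum_const, Finset.card_univ, Fintype.card_fun, Fintype.card_bool,
      Fintype.card_fin, nsmul_eq_mul]
    push_cast; linarith)
  have halt : ∀ k, IsDensity (alt k) := fun k =>
    isDensity_cellFun hQ hT hv (fun w => by have := hpos (w k); positivity) (by
      simp_rw [mul_add, mul_left_comm _ γ, mul_one, Finset.sum_add_distrib, ← Finset.mul_sum,
        sum_boolSign, Finset.sum_const, Finset.card_univ, Fintype.card_fun, Fintype.card_bool,
        Fintype.card_fin, nsmul_eq_mul]
      push_cast; linarith)
  have hexcess : ∀ j k, j ≠ k →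
      L / Real.sqrt 3 * Real.sqrt t ≤ excessRisk dict (alt k) (dict j) := by
    intro j k hjk
    have hinf : ⨅ i, sqDist (dict i) (alt k) ≤ sqDist (dict k) (alt k) :=
      ciInf_le (Set.finite_range _).bddBelow k
    have hj : sqDist (dict j) (alt k) = L ^ 2 * (1 + (1 + γ ^ 2) / 4) * 2 ^ M * δ := by
      rw [sqDist_cellFun hQ hT hδ hv, sum_sq_dict_sub, sum_boolSign_mul hjk]
      ring
    have hk : sqDist (dict k) (alt k) =
        L ^ 2 * (1 + (1 + γ ^ 2) / 4) * 2 ^ M * δ - 2 * L * γ := by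
      rw [sqDist_cellFun hQ hT hδ hv, sum_sq_dict_sub]
      simp_rw [← sq, boolSign_sq, sum_one_boolVec]
      linear_combination (-L * γ) * hδL
    have hrate : L / Real.sqrt 3 * Real.sqrt t = 2 * L * γ := div_sqrt_three_mul_sqrt L ht0
    unfold excessRisk
    linarith
  refine ⟨dict, fun j => ⟨memLp_cellFun hQ hT hv _, eLpNorm_top_cellFun_le hL.le fun w => ?_⟩, ?_⟩
  · rw [abs_mul, abs_boolSign, abs_of_pos hL, mul_one]
  rintro S ⟨J, hJ, hS⟩
  have hP0 := hnull.isProbabilityMeasure_sampleLaw n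
  obtain ⟨k, hk⟩ := exists_measureReal_preimage_le (sampleLaw n null) hM hJ
  have hPk := (halt k).isProbabilityMeasure_sampleLaw n
  have hB : MeasurableSet (J ⁻¹' {k}) := hJ (measurableSet_singleton k)
  refine ⟨alt k, ⟨halt k, eLpNorm_top_cellFun_le hL.le fun w => ?_⟩, ?_⟩
  · rw [abs_of_pos (by have := hpos (w k); positivity)]
    rcases boolSign_eq_or (w k) with h | h <;> rw [h] <;> nlinarith
  have hr : Measurable fun u => 1 + γ * boolSign (T u k) :=
    (measurable_of_finite fun w : Fin M → Bool => 1 + γ * boolSign (w k)).comp hT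
  have hsq : ∀ b, (1 + γ * boolSign b) ^ 2 = 1 + γ ^ 2 + 2 * γ * boolSign b := fun b => by
    linear_combination γ ^ 2 * boolSign_sq b
  have hinv : ∀ b, (1 + γ * boolSign b)⁻¹ = (1 - γ * boolSign b) / (1 - γ ^ 2) := fun b => by
    have h1 : 1 - γ ^ 2 ≠ 0 := by nlinarith
    have h2 := (hpos b).ne'
    field_simp
    linear_combination γ ^ 2 * boolSign_sq b
  have hto : ∀ a : ℝ, 0 < a → (sampleLaw n (alt k)).real (J ⁻¹' {k}) ≤
      a / 2 * (sampleLaw n null).real (J ⁻¹' {k}) + (1 + γ ^ 2) ^ n / (2 * a) := by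
    intro a ha
    refine sampleLaw_real_le_of_secondMoment (halt k) hnull hr (fun u => (hpos _).le)
      (fun u => ?_) (by positivity) ?_ ha hB
    · by_cases hu : u ∈ Q <;> simp [alt, null, cellFun, hu]
    · have : ∀ u, null u * (1 + γ * boolSign (T u k)) ^ 2 =
          cellFun Q T (fun w => L / 2 * (1 + γ * boolSign (w k)) ^ 2) u := fun u => by
        by_cases hu : u ∈ Q <;> simp [null, cellFun, hu]
      simp_rw [this]
      rw [lintegral_cellFun hQ hT hv fun w => by positivity]
      congr 1
      simp_rw [hsq, mul_add, ← mul_assoc, Finset.sum_add_distrib, ← Finset.mul_sum, sum_boolSign,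
        Finset.sum_const, Finset.card_univ, Fintype.card_fun, Fintype.card_bool,
        Fintype.card_fin, nsmul_eq_mul]
      push_cast
      linear_combination (1 + γ ^ 2) / 2 * hδL
  have hfrom : ∀ a : ℝ, 0 < a → (sampleLaw n null).real (J ⁻¹' {k})ᶜ ≤
      a / 2 * (sampleLaw n (alt k)).real (J ⁻¹' {k})ᶜ + (1 / (1 - γ ^ 2)) ^ n / (2 * a) := by
    intro a ha
    have h1 : 0 < 1 - γ ^ 2 := by nlinarith
    refine sampleLaw_real_le_of_secondMoment hnull (halt k) hr.inv
      (fun u => inv_nonneg.2 (hpos _).le) (fun u => ?_) (by positivity) ?_ ha hB.compl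
    · have := (hpos (T u k)).ne'
      by_cases hu : u ∈ Q <;> simp [alt, null, cellFun, hu, this]
    -- One factor of the inverse ratio cancels; averaging the other over signs gives `1 / (1 - γ ^
    -- 2)`.
    · have : ∀ u, alt k u * ((fun u => 1 + γ * boolSign (T u k))⁻¹ u) ^ 2 =
          cellFun Q T (fun w => L / 2 * (1 + γ * boolSign (w k))⁻¹) u := fun u => by
        have := (hpos (T u k)).ne'
        by_cases hu : u ∈ Q
        · simp [alt, cellFun, hu]; field_simp
        · simp [alt, cellFun, hu]
      simp_rw [this]
      rw [lintegral_cellFun hQ hT hv fun w => by have := hpos (w k); positivity]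
      congr 1
      simp_rw [hinv, ← mul_div_assoc, ← Finset.sum_div, mul_sub, ← mul_assoc,
        Finset.sum_sub_distrib, ← Finset.mul_sum, sum_boolSign,
        Finset.sum_const, Finset.card_univ, Fintype.card_fun, Fintype.card_bool,
        Fintype.card_fin, nsmul_eq_mul]
      push_cast
      field_simp
      linear_combination hδL
  simp only [probReal_compl_eq_one_sub hB] at hfrom
  have hlower := wrong_selection_lower_bound hM hx (sq_nonneg γ) (by nlinarith)
    (by rw [hγ2, ht]; field_simp)
    (p := 1 - (sampleLaw n null).real (J ⁻¹' {k}))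
    (q := 1 - (sampleLaw n (alt k)).real (J ⁻¹' {k}))
    (by simpa using hk) (by simpa using hto) hfrom
  rw [← probReal_compl_eq_one_sub hB] at hlower
  calc ENNReal.ofReal (1 / 24 * Real.exp (-x))
      ≤ ENNReal.ofReal ((sampleLaw n (alt k)).real (J ⁻¹' {k})ᶜ) := ENNReal.ofReal_le_ofReal hlower
    _ = sampleLaw n (alt k) (J ⁻¹' {k})ᶜ := ofReal_measureReal
    _ ≤ _ := measure_mono fun X hX => by
      rw [Set.mem_ofPred_eq, hS]
      exact hexcess _ _ hX
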